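/- Let $d\ge 2$ be an integer, $t\ge 0$ and $\varepsilon\in(0,1]$. For a $d\times d$ complex matrix $L$ (the Lindblad operator) with Hilbert--Schmidt norm $\|L\|_2=\sqrt{\operatorname{Tr}[LL^\dagger]}=1$, let $\mathcal L_L(\rho)=L\rho L^\dagger-\tfrac12\{L^\dagger L,\rho\}$ and $e^{\mathcal L_L t}=\sum_{k\ge 0}\frac{t^k}{k!}\mathcal L_L^k$, and let $\psi_L=|\psi_L\rangle\langle\psi_L|$ be the program state given by $|\psi_L\rangle=(L\otimes I)\sum_{i=1}^d|i\rangle|i\rangle$. Let the sample complexity $n_d^*(t,\varepsilon)$ be the least $n\in\{0,1,2,\dots\}$ for which there is a completely positive trace-preserving map $\mathcal P^{(n)}$ from operators on $\mathbb C^d\otimes(\mathbb C^d\otimes\mathbb C^d)^{\otimes n}$ to operators on $\mathbb C^d$, not depending on $L$, such that $$\tfrac12\left\|\mathcal P^{(n)}\circ\mathcal A_{\psi_L^{\otimes n}}-e^{\mathcal L_L t}\right\|_\diamond\le\varepsilon\qquad\text{for all } L \text{ with } \|L\|_2=1,$$ where $\mathcal A_{\psi_L^{\otimes n}}(\zeta)=\zeta\otimes\psi_L^{\otimes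 n}$ and $\|\Phi\|_\diamond$ is the supremum of the trace norm $\|(\mathrm{id}_R\otimes\Phi)(\rho)\|_1$ over all finite-dimensional reference systems $R$ and all density operators $\rho$ on $R\otimes\mathbb C^d$. Then, whenever $3d^2t^2/\varepsilon\ge 1$, $$n_d^*(t,\varepsilon)\le \frac{3d^2t^2}{\varepsilon},$$ and in all cases $n_d^*(t,\varepsilon)\le\left\lceil 3d^2t^2/\varepsilon\right\rceil$ (so that at most one program state suffices if $3d^2t^2/\varepsilon<1$). In particular $n_d^*(t,\varepsilon)$ is finite. -/

import Mathlib

open scoped ComplexOrder MatrixOrder Kronecker ENNReal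

noncomputable section

namespace LindbladSim

/-! Operators on a finite-dimensional Hilbert space with a fixed orthonormal basis indexed by `m`
are matrices `Matrix m m ℂ`; a superoperator is a linear map between such matrix spaces. -/

/-- The trace norm `‖X‖₁ = Tr[(X X†)^{1/2}]`. -/
def traceNorm {m : Type*} [Fintype m] [DecidableEq m] (X : Matrix m m ℂ) : ℝ :=
  (CFC.sqrt (X * X.conjTranspose)).trace.re

/-- The Hilbert-Schmidt norm `‖X‖₂ = (Tr[X X†])^{1/2}`. -/
def hilbertSchmidtNorm {m : Type*} [Fintype m] (X : Matrix m m ℂ) : ℝ :=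
  Real.sqrt (X * X.conjTranspose).trace.re

/-- Density operators: positive semidefinite matrices of unit trace. -/
def IsDensity {m : Type*} [Fintype m] (ρ : Matrix m m ℂ) : Prop :=
  ρ.PosSemidef ∧ ρ.trace = 1

/-- `id_R ⊗ Φ`, where the reference system `R` has basis `r`: the map `Φ` is applied to each
`R`-block of a matrix on `R ⊗ S`. -/
def ampliation (r : Type*) {m n : Type*}
    (Φ : Matrix m m ℂ →ₗ[ℂ] Matrix n n ℂ) :
    Matrix (r × m) (r × m) ℂ →ₗ[ℂ] Matrix (r × n) (r × n) ℂ where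
  toFun X := Matrix.of fun a b => Φ (Matrix.of fun i j => X (a.1, i) (b.1, j)) a.2 b.2
  map_add' X Y := by
    ext a b
    exact congrFun (congrFun (Φ.map_add (Matrix.of fun i j => X (a.1, i) (b.1, j))
      (Matrix.of fun i j => Y (a.1, i) (b.1, j))) a.2) b.2
  map_smul' c X := by
    ext a b
    exact congrFun (congrFun (Φ.map_smul c (Matrix.of fun i j => X (a.1, i) (b.1, j))) a.2) b.2

/-- Quantum channels: completely positive and trace-preserving maps. -/
def IsChannel {m n : Type*} [Fintype m] [Fintype n]
    (Φ : Matrix m m ℂ →ₗ[ℂ] Matrix n n ℂ) : Prop :=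
  (∀ (k : ℕ) (X : Matrix (Fin k × m) (Fin k × m) ℂ),
      X.PosSemidef → (ampliation (Fin k) Φ X).PosSemidef) ∧
    ∀ X : Matrix m m ℂ, (Φ X).trace = X.trace

/-- The diamond norm `sup_ρ ‖(id_R ⊗ Φ)(ρ)‖₁`, over all reference systems `R` of arbitrary
(finite) dimension and all density operators `ρ` on `R ⊗ S`, as an extended nonnegative real. -/
def diamondNorm {m n : Type*} [Fintype m] [Fintype n] [DecidableEq n]
    (Φ : Matrix m m ℂ →ₗ[ℂ] Matrix n n ℂ) : ℝ≥0∞ :=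
  ⨆ (k : ℕ) (ρ : Matrix (Fin k × m) (Fin k × m) ℂ) (_ : IsDensity ρ),
    ENNReal.ofReal (traceNorm (ampliation (Fin k) Φ ρ))

/-- The `n`-fold tensor power `κ^{⊗ n}`. -/
def tensorPower {m : Type*} (κ : Matrix m m ℂ) (n : ℕ) :
    Matrix (Fin n → m) (Fin n → m) ℂ :=
  Matrix.of fun a b => ∏ i, κ (a i) (b i)

/-- The appending map `ζ ↦ ζ ⊗ τ`. -/
def append {m p : Type*} (τ : Matrix p p ℂ) :
    Matrix m m ℂ →ₗ[ℂ] Matrix (m × p) (m × p) ℂ :=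
  (Matrix.kroneckerBilinear (R := ℂ) (α := ℂ)).flip τ

/-- The Lindbladian `ρ ↦ L ρ L† - (1/2) {L† L, ρ}` with the single Lindblad operator `L`. -/
def lindbladian {m : Type*} [Fintype m] (L : Matrix m m ℂ) :
    Module.End ℂ (Matrix m m ℂ) where
  toFun ρ := L * ρ * L.conjTranspose
    - (1 / 2 : ℂ) • (L.conjTranspose * L * ρ + ρ * (L.conjTranspose * L))
  map_add' ρ σ := by
    simp only [mul_add, add_mul, smul_add]
    abel
  map_smul' c ρ := by
    simp only [Matrix.mul_smul, Matrix.smul_mul, RingHom.id_apply, smul_sub, smul_add,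
      smul_comm c (1 / 2 : ℂ)]

/-- Convergence of the exponential series on a finite-dimensional normed space. -/
theorem summable_exp_series_aux {E : Type*} [NormedAddCommGroup E] [NormedSpace ℂ E]
    [FiniteDimensional ℂ E] (A : Module.End ℂ E) (t : ℝ) (x : E) :
    Summable fun k : ℕ => ((t ^ k / k.factorial : ℝ) : ℂ) • (A ^ k) x := by
  have : CompleteSpace E := FiniteDimensional.complete ℂ E
  let B : E →L[ℂ] E := LinearMap.toContinuousLinearMap A
  refine Summable.of_norm_bounded
    (g := fun k : ℕ => ((|t| * ‖B‖) ^ k / k.factorial) * ‖x‖)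
    ((Real.summable_pow_div_factorial _).mul_right _) fun k => ?_
  have h1 : ‖(A ^ k) x‖ ≤ ‖B‖ ^ k * ‖x‖ := by
    induction k with
    | zero => simp
    | succ k ih =>
      rw [pow_succ', Module.End.mul_apply, pow_succ']
      calc ‖A ((A ^ k) x)‖ ≤ ‖B‖ * ‖(A ^ k) x‖ := B.le_opNorm _
        _ ≤ ‖B‖ * (‖B‖ ^ k * ‖x‖) := by gcongr
        _ = ‖B‖ * ‖B‖ ^ k * ‖x‖ := by ring
  rw [norm_smul, Complex.norm_real, Real.norm_eq_abs, abs_div, abs_pow, Nat.abs_cast, mul_pow]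
  calc |t| ^ k / (k.factorial : ℝ) * ‖(A ^ k) x‖
      ≤ |t| ^ k / (k.factorial : ℝ) * (‖B‖ ^ k * ‖x‖) := by gcongr
    _ = |t| ^ k * ‖B‖ ^ k / (k.factorial : ℝ) * ‖x‖ := by ring

/-- The exponential series of a superoperator converges at every matrix. -/
theorem summable_exp_series {m : Type*} [Fintype m]
    (A : Module.End ℂ (Matrix m m ℂ)) (t : ℝ) (ρ : Matrix m m ℂ) :
    Summable fun k : ℕ => ((t ^ k / k.factorial : ℝ) : ℂ) • (A ^ k) ρ :=
  @summable_exp_series_aux (Matrix m m ℂ) Matrix.normedAddCommGroup Matrix.normedSpace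
    inferInstance A t ρ

/-- The evolution `e^{A t}(ρ) = ∑_k A^k(ρ) t^k / k!` generated by a superoperator `A`. -/
def evolution {m : Type*} [Fintype m] (A : Module.End ℂ (Matrix m m ℂ)) (t : ℝ) :
    Matrix m m ℂ →ₗ[ℂ] Matrix m m ℂ where
  toFun ρ := ∑' k : ℕ, ((t ^ k / k.factorial : ℝ) : ℂ) • (A ^ k) ρ
  map_add' ρ σ := by
    rw [← (summable_exp_series A t ρ).tsum_add (summable_exp_series A t σ)]
    simp only [map_add, smul_add]
  map_smul' c ρ := by
    rw [RingHom.id_apply, ← (summable_exp_series A t ρ).tsum_const_smul c]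
    simp only [map_smul, smul_comm c]

/-- The unnormalized maximally entangled vector `|Γ⟩ = ∑_i |i⟩|i⟩`. -/
def maxEntangled (d : ℕ) : Fin d × Fin d → ℂ := fun p => if p.1 = p.2 then 1 else 0

/-- The program vector `|ψ_L⟩ = (L ⊗ I)|Γ⟩`. -/
def programVector {d : ℕ} (L : Matrix (Fin d) (Fin d) ℂ) : Fin d × Fin d → ℂ :=
  (L ⊗ₖ (1 : Matrix (Fin d) (Fin d) ℂ)).mulVec (maxEntangled d)

/-- The program state `ψ_L = |ψ_L⟩⟨ψ_L|`. -/
def programState {d : ℕ} (L : Matrix (Fin d) (Fin d) ℂ) :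
    Matrix (Fin d × Fin d) (Fin d × Fin d) ℂ :=
  Matrix.vecMulVec (programVector L) (star (programVector L))

/-- `n` copies of the program state suffice for time `t` and error `ε` in dimension `d`: some
channel `P`, not depending on the Lindblad operator, satisfies
`(1/2) ‖P ∘ A_{ψ_L^{⊗ n}} - e^{𝓛 t}‖_⋄ ≤ ε` for every Lindblad operator `L` with `‖L‖₂ = 1`. -/
def Simulable (d : ℕ) (t ε : ℝ) (n : ℕ) : Prop :=
  ∃ P : Matrix (Fin d × (Fin n → Fin d × Fin d)) (Fin d × (Fin n → Fin d × Fin d)) ℂ →ₗ[ℂ]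
      Matrix (Fin d) (Fin d) ℂ,
    IsChannel P ∧
      ∀ L : Matrix (Fin d) (Fin d) ℂ, hilbertSchmidtNorm L = 1 →
        (1 / 2) * diamondNorm
            (P ∘ₗ append (tensorPower (programState L) n) - evolution (lindbladian L) t)
          ≤ ENNReal.ofReal ε

/-- The sample complexity `n_d^*(t, ε)` of sample-based single-operator Lindbladian simulation:
the least sufficient number of program states (`⊤` if no number suffices). -/
def sampleComplexity (d : ℕ) (t ε : ℝ) : ℕ∞ :=
  ⨅ (n : ℕ) (_ : Simulable d t ε n), (n : ℕ∞)

end LindbladSim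

end

noncomputable section

namespace LindbladSim

open Matrix

/-! ### Positive semidefinite matrices and the trace norm -/

section TraceNorm

variable {m : Type*} [Fintype m]

/-! One program state drives a first-order step of length `δ`. Let `E = |Γ⟩⟨Γ|₁₃ ⊗ I₂` on system and
program, so `E² = d E`. Applying `1 - (δ/2) E` and tracing out the program gives `ρ - (δ/2){L†L, ρ}
+ (δ²/4) Tr[LρL†] 1`. The operator `⟨Γ|₂₃ (SWAP₁₂ ⊗ I₃)` produces the jump `LρL†` and has `K†K = E`.
Giving it weight `δ - δ²d/4` makes the total trace preserving, and the step becomes `1 + δ𝓛` plus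
`(δ²/4)(Tr[LρL†] 1 - d LρL†)` (`sum_stepKraus`, `krausMap_stepKraus_comp_append`).

The extra term has diamond norm at most `dδ²/2`. Since `𝓛` has diamond norm at most 2, the Taylor
remainder of `e^{𝓛δ}` costs at most `4δ²`. For `d ≥ 2` a step therefore errs by at most `η =
(5/4)d²δ²` (`diamondBound_step_sub_evolution`). With `δ = t/n`, `n` sequential steps err by at most
`(1+η)^n - 1` (`DiamondBound.pow_sub_pow`), which is at most `2ε` once `3d²t² ≤ ε(n+1)`
(`simulable_of_le`).

Norm estimates are run through `DiamondBound`, the dual form `Re Tr[V (id ⊗ Φ)(ρ)] ≤ c Tr ρ` for `-1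
≤ V ≤ 1`. It is linear in `Φ`, hence stable under sums and convergent series, and it also composes;
the trace norm reappears only in `DiamondBound.diamondNorm_le`. -/

theorem re_trace_mul_nonneg [DecidableEq m] {A B : Matrix m m ℂ} (hA : A.PosSemidef)
    (hB : B.PosSemidef) : 0 ≤ (A * B).trace.re := by
  obtain ⟨C, rfl⟩ := CStarAlgebra.nonneg_iff_eq_star_mul_self.mp hA.nonneg
  rw [star_eq_conjTranspose, Matrix.mul_assoc, Matrix.trace_mul_comm]
  exact (Complex.le_def.mp (hB.mul_mul_conjTranspose_same C).trace_nonneg).1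

theorem continuousOn_spectrum [DecidableEq m] (f : ℝ → ℝ) (X : Matrix m m ℂ) :
    ContinuousOn f (spectrum ℝ X) :=
  (Matrix.finite_real_spectrum (A := X)).continuousOn f

/-- The Jordan decomposition of a Hermitian matrix, together with a contraction that witnesses
the trace norm. -/
theorem exists_jordan_decomposition [DecidableEq m] {X : Matrix m m ℂ} (hX : X.IsHermitian) :
    ∃ A B V : Matrix m m ℂ, A.PosSemidef ∧ B.PosSemidef ∧ X = A - B ∧
      (A + B) * (A + B) = X * X ∧ (1 - V).PosSemidef ∧ (1 + V).PosSemidef ∧ V * X = A + B := by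
  have hs : IsSelfAdjoint X := hX
  have hc := fun f => continuousOn_spectrum f X
  have hid : cfc (fun x : ℝ => x) X = X := cfc_id' ℝ X
  have h1 : cfc (fun _ : ℝ => (1 : ℝ)) X = 1 := cfc_const_one ℝ X
  have hadd : cfc (fun x : ℝ => max x 0) X + cfc (fun x : ℝ => max (-x) 0) X
      = cfc (fun x : ℝ => |x|) X := by
    rw [← cfc_add (a := X) (hf := hc _) (hg := hc _)]
    congr 1
    funext x
    rcases le_total 0 x with h | h
    · simp [h, abs_of_nonneg h]
    · simp [h, abs_of_nonpos h]
  -- `V` is the sign of `X`, so `V X = |X|`. Its value on the kernel is immaterial, but must lie in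
  -- `[-1, 1]`.
  refine ⟨cfc (fun x : ℝ => max x 0) X, cfc (fun x : ℝ => max (-x) 0) X,
    cfc (fun x : ℝ => if 0 ≤ x then 1 else -1) X, ?_, ?_, ?_, ?_, ?_, ?_, ?_⟩
  · exact nonneg_iff_posSemidef.mp (cfc_nonneg fun x _ => le_max_right _ _)
  · exact nonneg_iff_posSemidef.mp (cfc_nonneg fun x _ => le_max_right _ _)
  · rw [← cfc_sub (a := X) (hf := hc _) (hg := hc _)]
    nth_rewrite 1 [← hid]
    congr 1
    funext x
    rcases le_total 0 x with h | h <;> simp [h]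
  · rw [hadd, ← cfc_mul (a := X) (hf := hc _) (hg := hc _)]
    nth_rewrite 2 3 [← hid]
    rw [← cfc_mul (a := X) (hf := hc _) (hg := hc _)]
    simp only [abs_mul_abs_self]
  · rw [← h1, ← cfc_sub (a := X) (hf := hc _) (hg := hc _)]
    refine nonneg_iff_posSemidef.mp (cfc_nonneg fun x _ => ?_)
    split_ifs <;> norm_num
  · rw [← h1, ← cfc_add (a := X) (hf := hc _) (hg := hc _)]
    refine nonneg_iff_posSemidef.mp (cfc_nonneg fun x _ => ?_)
    split_ifs <;> norm_num
  · rw [hadd]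
    nth_rewrite 2 [← hid]
    rw [← cfc_mul (a := X) (hf := hc _) (hg := hc _)]
    congr 1
    funext x
    split_ifs with h
    · simp [abs_of_nonneg h]
    · simp [abs_of_neg (not_le.mp h)]

/-- Duality bound for the trace norm of a Hermitian matrix. -/
theorem traceNorm_le_of_forall [DecidableEq m] {X : Matrix m m ℂ} (hX : X.IsHermitian) {c : ℝ}
    (h : ∀ V : Matrix m m ℂ, (1 - V).PosSemidef → (1 + V).PosSemidef → (V * X).trace.re ≤ c) :
    traceNorm X ≤ c := by
  obtain ⟨A, B, V, hA, hB, -, hsq, hV, hV', hVX⟩ := exists_jordan_decomposition hX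
  have : CFC.sqrt (X * Xᴴ) = A + B := by
    rw [hX.eq]
    exact CFC.sqrt_unique hsq (hA.add hB).nonneg
  rw [traceNorm, this, ← hVX]
  exact h V hV hV'

/-- Nonnegative eigenvalues summing to 1 are each at most 1. Applied to `L†L` and `LL†`, this is how
the normalization of `L` enters the norm bounds. -/
theorem posSemidef_one_sub [DecidableEq m] {A : Matrix m m ℂ} (hA : A.PosSemidef)
    (htr : A.trace = 1) : (1 - A).PosSemidef := by
  have hs : IsSelfAdjoint A := hA.1
  have hid : cfc (fun x : ℝ => x) A = A := cfc_id' ℝ A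
  have h1 : cfc (fun _ : ℝ => (1 : ℝ)) A = 1 := cfc_const_one ℝ A
  have : 1 - A = cfc (fun x : ℝ => 1 - x) A := by
    rw [cfc_sub (a := A) (hf := continuousOn_spectrum _ _) (hg := continuousOn_spectrum _ _),
      hid, h1]
  rw [this]
  refine nonneg_iff_posSemidef.mp (cfc_nonneg fun x hx => ?_)
  rw [hA.1.spectrum_real_eq_range_eigenvalues] at hx
  obtain ⟨i, rfl⟩ := hx
  have hsum : ∑ j, hA.1.eigenvalues j = 1 := by
    have := congrArg Complex.re hA.1.trace_eq_sum_eigenvalues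
    rw [htr] at this
    simpa using this.symm
  have := Finset.single_le_sum (f := hA.1.eigenvalues) (fun j _ => hA.eigenvalues_nonneg j)
    (Finset.mem_univ i)
  linarith

end TraceNorm

/-! ### Kraus maps -/

section Kraus

variable {ι κ m n p r : Type*} [Fintype ι] [Fintype κ] [Fintype m]

/-- The completely positive map `X ↦ ∑ i, K i X (K i)†` with Kraus operators `K i`. -/
def krausMap (K : ι → Matrix n m ℂ) : Matrix m m ℂ →ₗ[ℂ] Matrix n n ℂ where
  toFun X := ∑ i, K i * X * (K i)ᴴ
  map_add' X Y := by simp only [Matrix.mul_add, Matrix.add_mul, Finset.sum_add_distrib]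
  map_smul' c X := by
    simp only [Matrix.mul_smul, Matrix.smul_mul, Finset.smul_sum, RingHom.id_apply]

theorem krausMap_apply (K : ι → Matrix n m ℂ) (X : Matrix m m ℂ) :
    krausMap K X = ∑ i, K i * X * (K i)ᴴ := rfl

theorem ampliation_apply {m n : Type*} (r : Type*) (Φ : Matrix m m ℂ →ₗ[ℂ] Matrix n n ℂ)
    (X : Matrix (r × m) (r × m) ℂ) (a b : r × n) :
    ampliation r Φ X a b = Φ (Matrix.of fun i j => X (a.1, i) (b.1, j)) a.2 b.2 := rfl

theorem ampliation_krausMap [Fintype r] [DecidableEq r] (K : ι → Matrix n m ℂ) :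
    ampliation r (krausMap K) = krausMap fun i => (1 : Matrix r r ℂ) ⊗ₖ K i := by
  ext X a b
  simp only [ampliation_apply, krausMap_apply, Matrix.sum_apply]
  refine Finset.sum_congr rfl fun i _ => ?_
  simp [Matrix.mul_apply, Matrix.kroneckerMap_apply, Fintype.sum_prod_type, Matrix.one_apply,
    ite_mul, mul_ite, apply_ite star]

theorem posSemidef_krausMap [Finite n] (K : ι → Matrix n m ℂ) {X : Matrix m m ℂ}
    (hX : X.PosSemidef) : (krausMap K X).PosSemidef :=
  Matrix.posSemidef_sum _ fun i _ => hX.mul_mul_conjTranspose_same (K i)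

theorem trace_krausMap [Fintype n] (K : ι → Matrix n m ℂ) (X : Matrix m m ℂ) :
    (krausMap K X).trace = ((∑ i, (K i)ᴴ * K i) * X).trace := by
  rw [krausMap_apply, Matrix.trace_sum, Finset.sum_mul, Matrix.trace_sum]
  refine Finset.sum_congr rfl fun i _ => ?_
  rw [Matrix.trace_mul_comm, ← Matrix.mul_assoc]

theorem isChannel_krausMap [Fintype n] [DecidableEq m] (K : ι → Matrix n m ℂ)
    (hK : ∑ i, (K i)ᴴ * K i = 1) : IsChannel (krausMap K) := by
  refine ⟨fun k X hX => ?_, fun X => ?_⟩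
  · rw [ampliation_krausMap]
    exact posSemidef_krausMap _ hX
  · rw [trace_krausMap, hK, one_mul]

theorem krausMap_comp [Fintype n] (K : ι → Matrix n m ℂ) (J : κ → Matrix p n ℂ) :
    krausMap J ∘ₗ krausMap K = krausMap fun x : κ × ι => J x.1 * K x.2 := by
  ext1 X
  simp only [LinearMap.comp_apply, krausMap_apply, Fintype.sum_prod_type, Matrix.mul_sum,
    Matrix.sum_mul, Matrix.conjTranspose_mul, Matrix.mul_assoc]

omit [Fintype m] in
theorem sum_conjTranspose_mul_comp [Fintype n] [Fintype p] [DecidableEq n]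
    (K : ι → Matrix n m ℂ) (J : κ → Matrix p n ℂ)
    (hJ : ∑ j, (J j)ᴴ * J j = 1) :
    ∑ x : κ × ι, (J x.1 * K x.2)ᴴ * (J x.1 * K x.2) = ∑ i, (K i)ᴴ * K i := by
  rw [Fintype.sum_prod_type_right]
  refine Finset.sum_congr rfl fun i _ => ?_
  have : ∀ j, (J j * K i)ᴴ * (J j * K i) = (K i)ᴴ * ((J j)ᴴ * J j) * K i := fun j => by
    simp only [Matrix.conjTranspose_mul, Matrix.mul_assoc]
  simp only [this]
  rw [← Matrix.sum_mul, ← Matrix.mul_sum, hJ, Matrix.mul_one]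

theorem conjTranspose_krausMap (K : ι → Matrix n m ℂ) (X : Matrix m m ℂ) :
    krausMap K Xᴴ = (krausMap K X)ᴴ := by
  simp only [krausMap_apply, Matrix.conjTranspose_sum, Matrix.conjTranspose_mul,
    Matrix.conjTranspose_conjTranspose, Matrix.mul_assoc]

end Kraus

/-! ### Bounds on the diamond norm -/

section DiamondBound

variable {m n p : Type*} [Fintype m] [Fintype n] [Fintype p] [DecidableEq n] [DecidableEq p]

/-- `Φ` preserves Hermiticity and has diamond norm at most `c`, the latter in dual form. -/
structure DiamondBound (Φ : Matrix m m ℂ →ₗ[ℂ] Matrix n n ℂ) (c : ℝ) : Prop where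
  map_conjTranspose : ∀ X, Φ Xᴴ = (Φ X)ᴴ
  re_trace_le : ∀ (k : ℕ) (ρ : Matrix (Fin k × m) (Fin k × m) ℂ), ρ.PosSemidef →
    ∀ V : Matrix (Fin k × n) (Fin k × n) ℂ, (1 - V).PosSemidef → (1 + V).PosSemidef →
      (V * ampliation (Fin k) Φ ρ).trace.re ≤ c * ρ.trace.re

namespace DiamondBound

variable {Φ Ψ : Matrix m m ℂ →ₗ[ℂ] Matrix n n ℂ} {c e : ℝ}

theorem isHermitian_ampliation (h : DiamondBound Φ c) {k : ℕ}
    {X : Matrix (Fin k × m) (Fin k × m) ℂ} (hX : X.IsHermitian) :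
    (ampliation (Fin k) Φ X).IsHermitian := by
  refine Matrix.IsHermitian.ext fun a b => ?_
  rw [ampliation_apply, ampliation_apply, ← Matrix.conjTranspose_apply, ← h.map_conjTranspose]
  have : (Matrix.of fun i j => X (b.1, i) (a.1, j))ᴴ
      = Matrix.of fun i j => X (a.1, i) (b.1, j) := by
    ext i j
    simp [hX.apply]
  rw [this]

theorem diamondNorm_le (h : DiamondBound Φ c) : diamondNorm Φ ≤ ENNReal.ofReal c := by
  refine iSup_le fun k => iSup_le fun ρ => iSup_le fun hρ => ENNReal.ofReal_le_ofReal ?_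
  refine traceNorm_le_of_forall (h.isHermitian_ampliation hρ.1.1) fun V hV hV' => ?_
  simpa [hρ.2] using h.re_trace_le k ρ hρ.1 V hV hV'

theorem mono (h : DiamondBound Φ c) (hce : c ≤ e) : DiamondBound Φ e where
  map_conjTranspose := h.map_conjTranspose
  re_trace_le k ρ hρ V hV hV' := (h.re_trace_le k ρ hρ V hV hV').trans
    (mul_le_mul_of_nonneg_right hce (Complex.le_def.mp hρ.trace_nonneg).1)

theorem add (h : DiamondBound Φ c) (h' : DiamondBound Ψ e) : DiamondBound (Φ + Ψ) (c + e) where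
  map_conjTranspose X := by
    simp [h.map_conjTranspose, h'.map_conjTranspose]
  re_trace_le k ρ hρ V hV hV' := by
    have : ampliation (Fin k) (Φ + Ψ) ρ = ampliation (Fin k) Φ ρ + ampliation (Fin k) Ψ ρ := rfl
    rw [this, mul_add, Matrix.trace_add, Complex.add_re, add_mul]
    exact add_le_add (h.re_trace_le k ρ hρ V hV hV') (h'.re_trace_le k ρ hρ V hV hV')

theorem neg (h : DiamondBound Φ c) : DiamondBound (-Φ) c where
  map_conjTranspose X := by simp [h.map_conjTranspose]
  re_trace_le k ρ hρ V hV hV' := by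
    have : ampliation (Fin k) (-Φ) ρ = -ampliation (Fin k) Φ ρ := rfl
    rw [this, mul_neg, ← neg_mul]
    exact h.re_trace_le k ρ hρ (-V) (by simpa using hV') (by simpa [sub_eq_add_neg] using hV)

theorem sub (h : DiamondBound Φ c) (h' : DiamondBound Ψ e) : DiamondBound (Φ - Ψ) (c + e) := by
  rw [sub_eq_add_neg]
  exact h.add h'.neg

theorem smul (h : DiamondBound Φ c) {a : ℝ} (ha : 0 ≤ a) :
    DiamondBound ((a : ℂ) • Φ) (a * c) where
  map_conjTranspose X := by simp [h.map_conjTranspose]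
  re_trace_le k ρ hρ V hV hV' := by
    have : ampliation (Fin k) ((a : ℂ) • Φ) ρ = (a : ℂ) • ampliation (Fin k) Φ ρ := rfl
    rw [this, Matrix.mul_smul, Matrix.trace_smul, smul_eq_mul, Complex.re_ofReal_mul, mul_assoc]
    exact mul_le_mul_of_nonneg_left (h.re_trace_le k ρ hρ V hV hV') ha

/-- The Hermitian output of `Φ` splits as `A - B` with `A, B ≥ 0`. The sign witness for `Φ` bounds
`Tr(A + B)`, and `Θ` is tested on `A` with `V` and on `B` with `-V`. -/
theorem comp {Θ : Matrix n n ℂ →ₗ[ℂ] Matrix p p ℂ} (h' : DiamondBound Θ e)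
    (h : DiamondBound Φ c) (he : 0 ≤ e) : DiamondBound (Θ ∘ₗ Φ) (e * c) where
  map_conjTranspose X := by simp [h.map_conjTranspose, h'.map_conjTranspose]
  re_trace_le k ρ hρ V hV hV' := by
    have hcomp : ampliation (Fin k) (Θ ∘ₗ Φ) ρ
        = ampliation (Fin k) Θ (ampliation (Fin k) Φ ρ) := rfl
    obtain ⟨A, B, W, hA, hB, hAB, -, hW, hW', htr⟩ :=
      exists_jordan_decomposition (h.isHermitian_ampliation (k := k) hρ.1)
    have h1 := h'.re_trace_le k A hA V hV hV'
    have h2 := h'.re_trace_le k B hB (-V) (by simpa using hV') (by simpa [sub_eq_add_neg] using hV)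
    have h3 := h.re_trace_le k ρ hρ W hW hW'
    rw [htr, Matrix.trace_add, Complex.add_re] at h3
    rw [hcomp, hAB, map_sub, mul_sub, Matrix.trace_sub, Complex.sub_re]
    rw [neg_mul, Matrix.trace_neg, Complex.neg_re] at h2
    nlinarith [mul_le_mul_of_nonneg_left h3 he]

/-- Since `V ≤ 1` and `-V ≤ 1`, the pairing is at most the sum of the two output traces, which is
the trace of `ρ` against the sum of all `K†K` and `J†J`. -/
theorem krausMap_sub [DecidableEq m] {ι κ : Type*} [Fintype ι] [Fintype κ] (K : ι → Matrix n m ℂ)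
    (J : κ → Matrix n m ℂ)
    (h : (((c : ℂ) • (1 : Matrix m m ℂ))
      - (∑ i, (K i)ᴴ * K i + ∑ j, (J j)ᴴ * J j)).PosSemidef) :
    DiamondBound (krausMap K - krausMap J) c where
  map_conjTranspose X := by simp [conjTranspose_krausMap]
  re_trace_le k ρ hρ V hV hV' := by
    have hsub : ampliation (Fin k) (krausMap K - krausMap J) ρ
        = ampliation (Fin k) (krausMap K) ρ - ampliation (Fin k) (krausMap J) ρ := rfl
    rw [hsub, ampliation_krausMap, ampliation_krausMap, mul_sub, Matrix.trace_sub,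
      Complex.sub_re]
    have hK := re_trace_mul_nonneg hV
      (posSemidef_krausMap (fun i => (1 : Matrix (Fin k) (Fin k) ℂ) ⊗ₖ K i) hρ)
    have hJ := re_trace_mul_nonneg hV'
      (posSemidef_krausMap (fun i => (1 : Matrix (Fin k) (Fin k) ℂ) ⊗ₖ J i) hρ)
    have hc := re_trace_mul_nonneg ((PosSemidef.one (n := Fin k) (R := ℂ)).kronecker h) hρ
    rw [sub_mul, one_mul, Matrix.trace_sub, Complex.sub_re, trace_krausMap] at hK
    rw [add_mul, one_mul, Matrix.trace_add, Complex.add_re, trace_krausMap] at hJ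
    have key : (1 : Matrix (Fin k) (Fin k) ℂ) ⊗ₖ (((c : ℂ) • (1 : Matrix m m ℂ))
        - (∑ i, (K i)ᴴ * K i + ∑ j, (J j)ᴴ * J j))
        = (c : ℂ) • 1 - (∑ i, ((1 : Matrix (Fin k) (Fin k) ℂ) ⊗ₖ K i)ᴴ
            * ((1 : Matrix (Fin k) (Fin k) ℂ) ⊗ₖ K i)
          + ∑ i, ((1 : Matrix (Fin k) (Fin k) ℂ) ⊗ₖ J i)ᴴ
            * ((1 : Matrix (Fin k) (Fin k) ℂ) ⊗ₖ J i)) := by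
      have hmul : ∀ Y : Matrix n m ℂ, ((1 : Matrix (Fin k) (Fin k) ℂ) ⊗ₖ Y)ᴴ
          * ((1 : Matrix (Fin k) (Fin k) ℂ) ⊗ₖ Y)
          = (1 : Matrix (Fin k) (Fin k) ℂ) ⊗ₖ (Yᴴ * Y) := fun Y => by
        rw [Matrix.conjTranspose_kronecker, ← Matrix.mul_kronecker_mul, Matrix.conjTranspose_one,
          mul_one]
      simp only [hmul]
      have hlin : ∀ Y : Matrix m m ℂ, (1 : Matrix (Fin k) (Fin k) ℂ) ⊗ₖ Y
          = Matrix.kroneckerBilinear (R := ℂ) (α := ℂ) 1 Y := fun _ => rfl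
      simp only [hlin]
      rw [map_sub, map_add, map_sum, map_sum, map_smul, ← hlin 1, Matrix.one_kronecker_one]
    rw [key, sub_mul, add_mul, Matrix.trace_sub, Matrix.trace_add, Matrix.smul_mul, one_mul,
      Matrix.trace_smul, Complex.sub_re, Complex.add_re, smul_eq_mul, Complex.re_ofReal_mul] at hc
    linarith

theorem krausMap [DecidableEq m] {ι : Type*} [Fintype ι] (K : ι → Matrix n m ℂ)
    (h : (((c : ℂ) • (1 : Matrix m m ℂ)) - ∑ i, (K i)ᴴ * K i).PosSemidef) :
    DiamondBound (krausMap K) c := by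
  have := krausMap_sub K (fun i : Empty => i.elim) (c := c) (by simpa using h)
  have h0 : LindbladSim.krausMap (fun i : Empty => i.elim)
      = (0 : Matrix m m ℂ →ₗ[ℂ] Matrix n n ℂ) := by
    ext1 X
    simp [krausMap_apply]
  rwa [h0, sub_zero] at this

theorem krausMap_of_sum_eq_one [DecidableEq m] {ι : Type*} [Fintype ι] (K : ι → Matrix n m ℂ)
    (h : ∑ i, (K i)ᴴ * K i = 1) : DiamondBound (LindbladSim.krausMap K) 1 :=
  DiamondBound.krausMap K (by simpa [h] using PosSemidef.zero)

theorem one : DiamondBound (1 : Module.End ℂ (Matrix n n ℂ)) 1 := by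
  have h := krausMap_of_sum_eq_one (fun _ : Unit => (1 : Matrix n n ℂ)) (by simp)
  have h1 : LindbladSim.krausMap (fun _ : Unit => (1 : Matrix n n ℂ))
      = (1 : Module.End ℂ (Matrix n n ℂ)) := by
    ext1 X
    simp [krausMap_apply]
  rwa [h1] at h

theorem pow {Λ : Module.End ℂ (Matrix n n ℂ)} (h : DiamondBound Λ c) (hc : 0 ≤ c)
    (k : ℕ) : DiamondBound (Λ ^ k) (c ^ k) := by
  induction k with
  | zero => simpa using one (n := n)
  | succ k ih =>
    rw [pow_succ', pow_succ']
    exact h.comp ih hc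

/-- For fixed `ρ` and `V` the pairing is a continuous linear functional of the output, so the
termwise bounds can be summed. -/
theorem of_hasSum {Φs : ℕ → Matrix m m ℂ →ₗ[ℂ] Matrix n n ℂ} {cs : ℕ → ℝ}
    (h : ∀ k, DiamondBound (Φs k) (cs k)) (hΦ : ∀ X, HasSum (fun k => Φs k X) (Φ X))
    (hc : HasSum cs c) : DiamondBound Φ c where
  map_conjTranspose X := by
    refine (hΦ Xᴴ).unique ?_
    simp only [(h _).map_conjTranspose]
    exact (hΦ X).matrix_conjTranspose
  re_trace_le k ρ hρ V hV hV' := by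
    refine hasSum_le (fun j => (h j).re_trace_le k ρ hρ V hV hV') ?_ (hc.mul_right _)
    have hamp : HasSum (fun j => ampliation (Fin k) (Φs j) ρ) (ampliation (Fin k) Φ ρ) := by
      refine Pi.hasSum.mpr fun a => Pi.hasSum.mpr fun b => ?_
      exact Pi.hasSum.mp (Pi.hasSum.mp
        (hΦ (Matrix.of fun i j => ρ (a.1, i) (b.1, j))) a.2) b.2
    have hcont : Continuous fun Y : Matrix (Fin k × n) (Fin k × n) ℂ => (V * Y).trace := by
      fun_prop
    exact Complex.hasSum_re (hamp.map ((Matrix.traceAddMonoidHom _ ℂ).comp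
      (AddMonoidHom.mulLeft V)) hcont)

end DiamondBound

end DiamondBound

/-! ### The evolution generated by a superoperator -/

section Evolution

/-- Identifies the pointwise series with the operator exponential. The space is abstract so that a
norm on matrices can be supplied explicitly at the point of use. -/
theorem hasSum_exp_series_aux {E : Type*} [NormedAddCommGroup E] [NormedSpace ℂ E]
    [FiniteDimensional ℂ E] [CompleteSpace E] (A : Module.End ℂ E) (t : ℝ) (x : E) :
    HasSum (fun k : ℕ => ((t ^ k / k.factorial : ℝ) : ℂ) • (A ^ k) x)
      (NormedSpace.exp ((t : ℂ) • LinearMap.toContinuousLinearMap A) x) := by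
  set B : E →L[ℂ] E := LinearMap.toContinuousLinearMap A with hB
  have h := NormedSpace.exp_series_hasSum_exp' (𝕂 := ℂ) ((t : ℂ) • B)
  have h' := h.mapL (ContinuousLinearMap.apply ℂ E x)
  have hpow : ∀ k : ℕ, (B ^ k) x = (A ^ k) x := fun k => by
    induction k with
    | zero => rfl
    | succ k ih =>
      rw [pow_succ', pow_succ', Module.End.mul_apply, ← ih]
      rfl
  refine h'.congr_fun fun k => ?_
  simp only [ContinuousLinearMap.apply_apply, smul_pow, _root_.smul_apply, hpow, smul_smul]
  congr 1
  push_cast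
  ring

/-- The semigroup law `exp(n B) = exp(B)^n`, transported to the pointwise series. -/
theorem exp_series_natCast_mul_aux {E : Type*} [NormedAddCommGroup E] [NormedSpace ℂ E]
    [FiniteDimensional ℂ E] (A T : Module.End ℂ E) (t : ℝ)
    (hT : ∀ x, HasSum (fun k : ℕ => ((t ^ k / k.factorial : ℝ) : ℂ) • (A ^ k) x) (T x))
    (n : ℕ) (x : E) :
    HasSum (fun k : ℕ => (((n * t) ^ k / k.factorial : ℝ) : ℂ) • (A ^ k) x) ((T ^ n) x) := by
  have : CompleteSpace E := FiniteDimensional.complete ℂ E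
  have h := hasSum_exp_series_aux A (n * t) x
  have hTexp : ∀ y, T y = NormedSpace.exp ((t : ℂ) • LinearMap.toContinuousLinearMap A) y :=
    fun y => (hT y).unique (hasSum_exp_series_aux A t y)
  have hsmul : ((n * t : ℝ) : ℂ) • LinearMap.toContinuousLinearMap A
      = n • ((t : ℂ) • LinearMap.toContinuousLinearMap A) := by
    rw [← Nat.cast_smul_eq_nsmul ℂ, smul_smul]
    push_cast
    rfl
  have : NormedAlgebra ℚ (E →L[ℂ] E) := NormedAlgebra.restrictScalars ℚ ℂ _
  rw [hsmul, NormedSpace.exp_nsmul] at h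
  convert h using 1
  clear h hsmul
  induction n with
  | zero => rfl
  | succ n ih =>
    rw [pow_succ', pow_succ', Module.End.mul_apply, ih, hTexp]
    rfl

variable {m : Type*} [Fintype m]

theorem hasSum_evolution (A : Module.End ℂ (Matrix m m ℂ)) (t : ℝ) (ρ : Matrix m m ℂ) :
    HasSum (fun k : ℕ => ((t ^ k / k.factorial : ℝ) : ℂ) • (A ^ k) ρ) (evolution A t ρ) :=
  (summable_exp_series A t ρ).hasSum

theorem evolution_natCast_mul (A : Module.End ℂ (Matrix m m ℂ)) (t : ℝ) (n : ℕ) :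
    evolution A (n * t) = (evolution A t : Module.End ℂ (Matrix m m ℂ)) ^ n := by
  ext1 ρ
  exact (hasSum_evolution A (n * t) ρ).unique
    (@exp_series_natCast_mul_aux (Matrix m m ℂ) Matrix.normedAddCommGroup Matrix.normedSpace
      inferInstance A (evolution A t) t (hasSum_evolution A t) n ρ)

/-- Second-order Taylor remainder of the evolution. -/
theorem DiamondBound.evolution_sub [DecidableEq m] {A : Module.End ℂ (Matrix m m ℂ)} {c t : ℝ}
    (hA : DiamondBound A c) (hc : 0 ≤ c) (ht : 0 ≤ t) :
    DiamondBound (evolution A t - 1 - (t : ℂ) • A) (Real.exp (c * t) - 1 - c * t) := by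
  refine DiamondBound.of_hasSum
    (Φs := fun k => (((t ^ (k + 2) / (k + 2).factorial : ℝ)) : ℂ) • A ^ (k + 2))
    (cs := fun k => t ^ (k + 2) / (k + 2).factorial * c ^ (k + 2))
    (fun k => (hA.pow hc (k + 2)).smul (by positivity)) (fun X => ?_) ?_
  · have := (hasSum_nat_add_iff' 2).mpr (hasSum_evolution A t X)
    simpa [Finset.sum_range_succ, sub_sub] using this
  · have h : HasSum (fun k : ℕ => t ^ k / k.factorial * c ^ k) (Real.exp (c * t)) := by
      rw [Real.exp_eq_exp_ℝ]
      refine (NormedSpace.exp_series_hasSum_exp' (𝕂 := ℝ) (c * t)).congr_fun fun k => ?_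
      rw [smul_eq_mul, mul_pow]
      ring
    have := (hasSum_nat_add_iff' 2).mpr h
    simpa [Finset.sum_range_succ, sub_sub, mul_comm c t] using this

/-- Stability of powers: a perturbation of size `η` of a contraction accumulates at most
`(1 + η) ^ n - 1` in `n` steps. -/
theorem DiamondBound.pow_sub_pow [DecidableEq m] {S T : Module.End ℂ (Matrix m m ℂ)} {η : ℝ}
    (hS : DiamondBound S 1) (hST : DiamondBound (S - T) η) (hη : 0 ≤ η) (n : ℕ) :
    DiamondBound (S ^ n - T ^ n) ((1 + η) ^ n - 1) := by
  -- `T = S - (S - T)`, so there is no need to know that `T`, later the exact evolution, is itself a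
  -- contraction.
  have hT : DiamondBound T (1 + η) := by
    simpa using hS.sub hST
  induction n with
  -- The difference rule only gives the bound `1 + 1`; scaling by 0 turns it into the bound 0 for
  -- the zero map.
  | zero => simpa using (DiamondBound.one (n := m)).sub DiamondBound.one |>.smul le_rfl
  | succ n ih =>
    have h : S ^ (n + 1) - T ^ (n + 1) = (S - T) * S ^ n + T * (S ^ n - T ^ n) := by
      rw [pow_succ', pow_succ', sub_mul, mul_sub]
      abel
    rw [h]
    refine ((hST.comp (hS.pow zero_le_one n) hη).add (hT.comp ih (by positivity))).mono ?_
    rw [one_pow, pow_succ]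
    linarith

end Evolution

/-! ### Sequential use of a program-controlled channel -/

section Sequential

variable {m p : Type*} [Fintype m] [Fintype p] [DecidableEq m] [DecidableEq p]

theorem append_apply {m p : Type*} (τ : Matrix p p ℂ) (X : Matrix m m ℂ) :
    append τ X = X ⊗ₖ τ := rfl

/-- If `krausMap K` consumes one program register, then some channel consumes `n` of them and acts,
on `n` copies of any program operator, as the `n`-th power of the single-program map. -/
theorem exists_sequential_channel {ι : Type} [Fintype ι] (K : ι → Matrix m (m × p) ℂ)
    (hK : ∑ i, (K i)ᴴ * K i = 1) (n : ℕ) :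
    ∃ (κ : Type) (_ : Fintype κ) (J : κ → Matrix m (m × (Fin n → p)) ℂ),
      ∑ j, (J j)ᴴ * J j = 1 ∧ ∀ τ : Matrix p p ℂ,
        krausMap J ∘ₗ append (tensorPower τ n)
          = (krausMap K ∘ₗ append τ : Module.End ℂ (Matrix m m ℂ)) ^ n := by
  induction n with
  | zero =>
    refine ⟨Unit, inferInstance, fun _ => (1 : Matrix m m ℂ).submatrix id Prod.fst, ?_,
      fun τ => ?_⟩
    · ext ⟨a, f⟩ ⟨b, g⟩
      simp [Matrix.mul_apply, Matrix.one_apply, Subsingleton.elim f g]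
    · ext1 X
      rw [LinearMap.comp_apply, append_apply, krausMap_apply, pow_zero]
      ext a b
      simp [Matrix.mul_apply, Matrix.one_apply, Fintype.sum_prod_type, tensorPower]
  | succ n ih =>
    obtain ⟨κ, _, J, hJ, hJτ⟩ := ih
    -- Regrouping that puts the first program register next to the system; `W` acts with `K` on
    -- these two and leaves the other `n` registers to `J`.
    let e : m × (Fin (n + 1) → p) ≃ (m × p) × (Fin n → p) :=
      ((Equiv.refl m).prodCongr (Fin.consEquiv fun _ => p).symm).trans
        (Equiv.prodAssoc m p (Fin n → p)).symm
    let W : ι → Matrix (m × (Fin n → p)) (m × (Fin (n + 1) → p)) ℂ := fun i =>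
      (K i ⊗ₖ (1 : Matrix (Fin n → p) (Fin n → p) ℂ)).submatrix id e
    have hWW : ∀ i, (W i)ᴴ * W i
        = (((K i)ᴴ * K i) ⊗ₖ (1 : Matrix (Fin n → p) (Fin n → p) ℂ)).submatrix e e := fun i => by
      simp only [W]
      rw [Matrix.conjTranspose_submatrix, ← Matrix.submatrix_mul _ _ _ _ _ Function.bijective_id,
        Matrix.conjTranspose_kronecker, ← Matrix.mul_kronecker_mul, Matrix.conjTranspose_one,
        mul_one]
    have hW : ∑ i, (W i)ᴴ * W i = 1 := by
      simp only [hWW]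
      ext a b
      have h := congrFun (congrFun hK (e a).1) (e b).1
      rw [Matrix.sum_apply] at h
      rw [Matrix.sum_apply]
      simp only [Matrix.submatrix_apply, Matrix.kroneckerMap_apply]
      rw [← Finset.sum_mul, h, ← Matrix.kroneckerMap_apply (· * ·), Matrix.one_kronecker_one,
        ← Matrix.submatrix_apply (1 : Matrix ((m × p) × (Fin n → p)) _ ℂ) e e,
        Matrix.submatrix_one_equiv]
    have hWτ : ∀ τ : Matrix p p ℂ, krausMap W ∘ₗ append (tensorPower τ (n + 1))
        = append (tensorPower τ n) ∘ₗ (krausMap K ∘ₗ append τ) := fun τ => by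
      ext1 X
      have happ : X ⊗ₖ tensorPower τ (n + 1)
          = ((X ⊗ₖ τ) ⊗ₖ tensorPower τ n).submatrix e e := by
        ext ⟨a, f⟩ ⟨b, g⟩
        simp [e, tensorPower, Fin.prod_univ_succ, mul_assoc, Fin.consEquiv, Fin.tail]
      have hterm : ∀ i, W i * (X ⊗ₖ tensorPower τ (n + 1)) * (W i)ᴴ
          = (K i * (X ⊗ₖ τ) * (K i)ᴴ) ⊗ₖ tensorPower τ n := fun i => by
        simp only [W]
        rw [happ, Matrix.conjTranspose_submatrix, Matrix.submatrix_mul_equiv,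
          Matrix.submatrix_mul_equiv, Matrix.conjTranspose_kronecker,
          ← Matrix.mul_kronecker_mul, ← Matrix.mul_kronecker_mul, Matrix.conjTranspose_one,
          mul_one, one_mul, Matrix.submatrix_id_id]
      simp only [LinearMap.comp_apply, append_apply, krausMap_apply, hterm]
      ext a b
      simp [Matrix.sum_apply, Finset.sum_mul]
    refine ⟨κ × ι, inferInstance, fun x => J x.1 * W x.2, ?_, fun τ => ?_⟩
    · rw [sum_conjTranspose_mul_comp W J hJ, hW]
    · rw [← krausMap_comp, LinearMap.comp_assoc, hWτ, ← LinearMap.comp_assoc, hJτ, pow_succ]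
      rfl

/-- Appending a pure state is conjugation by the isometry `1 ⊗ |v⟩`. -/
theorem DiamondBound.append_vecMulVec (v : p → ℂ) (hv : star v ⬝ᵥ v = 1) :
    DiamondBound (append (vecMulVec v (star v)) : Matrix m m ℂ →ₗ[ℂ] _) 1 := by
  have h := DiamondBound.krausMap_of_sum_eq_one
    (fun _ : Unit => (Matrix.of fun (x : m × p) (b : m) => if x.1 = b then v x.2 else 0)) (by
      ext a b
      simp only [dotProduct, Pi.star_apply, RCLike.star_def] at hv
      simp [Matrix.mul_apply, Matrix.one_apply, Fintype.sum_prod_type, apply_ite, hv, eq_comm])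
  convert h using 1
  ext1 X
  rw [append_apply, krausMap_apply]
  ext ⟨a, i⟩ ⟨b, j⟩
  simp [Matrix.mul_apply, vecMulVec_apply, apply_ite]
  ring

end Sequential

/-! ### The Lindbladian -/

section Lindblad

variable {m : Type*} [Fintype m]

theorem trace_mul_conjTranspose_eq_one {L : Matrix m m ℂ} (hL : hilbertSchmidtNorm L = 1) :
    (L * Lᴴ).trace = 1 := by
  have h0 := Complex.le_def.mp (Matrix.posSemidef_self_mul_conjTranspose L).trace_nonneg
  have h1 := Real.sqrt_eq_one.mp hL
  exact Complex.ext h1 h0.2.symm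

variable [DecidableEq m]

/-- Polarization: with `H = L†L`, `(1 - H)ρ(1 - H) - (1 + H)ρ(1 + H) = -2{H, ρ}`. This exhibits the
generator as a difference of completely positive maps. -/
theorem lindbladian_eq_krausMap_sub (L : Matrix m m ℂ) :
    lindbladian L = krausMap ![L, (1 / 2 : ℂ) • (1 - Lᴴ * L)]
      - krausMap (fun _ : Unit => (1 / 2 : ℂ) • (1 + Lᴴ * L)) := by
  ext1 ρ
  have h : (Lᴴ * L)ᴴ = Lᴴ * L := by simp
  simp only [lindbladian, LinearMap.coe_mk, AddHom.coe_mk, LinearMap.sub_apply, krausMap_apply,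
    Fin.sum_univ_two, Matrix.cons_val_zero, Matrix.cons_val_one, Finset.univ_unique,
    Finset.sum_singleton, Matrix.conjTranspose_smul, Matrix.conjTranspose_sub,
    Matrix.conjTranspose_add, Matrix.conjTranspose_one, h]
  generalize Lᴴ * L = H
  have h2 : star (1 / 2 : ℂ) = 1 / 2 := by simp
  rw [h2]
  simp only [Matrix.smul_mul, Matrix.mul_smul, sub_mul, mul_sub, add_mul, mul_add,
    one_mul, mul_one]
  module

theorem diamondBound_lindbladian {L : Matrix m m ℂ} (hL : (L * Lᴴ).trace = 1) :
    DiamondBound (lindbladian L) 2 := by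
  rw [lindbladian_eq_krausMap_sub]
  refine DiamondBound.krausMap_sub _ _ ?_
  have hH : (1 - Lᴴ * L).PosSemidef :=
    posSemidef_one_sub (Matrix.posSemidef_conjTranspose_mul_self L)
      (by rw [Matrix.trace_mul_comm, hL])
  have hH' : (Lᴴ * (1 - L * Lᴴ) * L).PosSemidef :=
    (posSemidef_one_sub (Matrix.posSemidef_self_mul_conjTranspose L)
      hL).conjTranspose_mul_mul_same L
  -- The Kraus sums add up to `H + (1 + H²)/2`, and `2 - H - (1 + H²)/2 = (3/2)(1 - H) + (1/2)(H -
  -- H²)`.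
  have hsum := (hH.smul (α := ℝ) (a := 3 / 2) (by norm_num)).add
    (hH'.smul (α := ℝ) (a := 1 / 2) (by norm_num))
  convert hsum using 1
  have h : (Lᴴ * L)ᴴ = Lᴴ * L := by simp
  have h' : Lᴴ * (1 - L * Lᴴ) * L = Lᴴ * L - (Lᴴ * L) * (Lᴴ * L) := by
    simp only [mul_sub, sub_mul, mul_one, Matrix.mul_assoc]
  rw [h']
  simp only [Fin.sum_univ_two, Matrix.cons_val_zero, Matrix.cons_val_one, Finset.univ_unique,
    Finset.sum_singleton, Matrix.conjTranspose_smul, Matrix.conjTranspose_sub,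
    Matrix.conjTranspose_add, Matrix.conjTranspose_one, h]
  generalize Lᴴ * L = H
  have h2 : star (1 / 2 : ℂ) = 1 / 2 := by simp
  rw [h2]
  simp only [Matrix.smul_mul, Matrix.mul_smul, sub_mul, mul_sub, add_mul, mul_add,
    one_mul, mul_one]
  have hr : ∀ (r : ℝ) (Y : Matrix m m ℂ), r • Y = (r : ℂ) • Y := fun r Y => by
    ext i j
    simp
  simp only [hr]
  push_cast
  module

/-- The map `ρ ↦ L ρ L†`. -/
def jumpMap (L : Matrix m m ℂ) : Module.End ℂ (Matrix m m ℂ) := krausMap fun _ : Unit => L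

/-- The map `ρ ↦ Tr[L ρ L†] 1`. -/
def depolarizedJumpMap (L : Matrix m m ℂ) : Module.End ℂ (Matrix m m ℂ) :=
  krausMap fun x : m × m => Matrix.single x.1 x.2 1 * L

omit [DecidableEq m] in
theorem jumpMap_apply (L ρ : Matrix m m ℂ) : jumpMap L ρ = L * ρ * Lᴴ := by
  simp [jumpMap, krausMap_apply]

theorem depolarizedJumpMap_apply (L ρ : Matrix m m ℂ) :
    depolarizedJumpMap L ρ = (L * ρ * Lᴴ).trace • 1 := by
  have h : ∀ x : m × m, Matrix.single x.1 x.2 (1 : ℂ) * L * ρ * (Matrix.single x.1 x.2 1 * L)ᴴ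
      = Matrix.single x.1 x.1 ((L * ρ * Lᴴ) x.2 x.2) := fun x => by
    rw [Matrix.conjTranspose_mul, Matrix.conjTranspose_single, star_one]
    calc _ = Matrix.single x.1 x.2 (1 : ℂ) * (L * ρ * Lᴴ) * Matrix.single x.2 x.1 1 := by
          simp only [Matrix.mul_assoc]
      _ = _ := by rw [Matrix.single_mul_mul_single]; simp
  simp only [depolarizedJumpMap, krausMap_apply, h, Fintype.sum_prod_type]
  ext a b
  simp [Matrix.sum_apply, Matrix.single_apply, Matrix.one_apply, Matrix.trace, ite_and]

theorem diamondBound_jumpMap {L : Matrix m m ℂ} (hL : (L * Lᴴ).trace = 1) :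
    DiamondBound (jumpMap L) 1 := by
  refine DiamondBound.krausMap _ ?_
  simpa using posSemidef_one_sub (Matrix.posSemidef_conjTranspose_mul_self L)
      (by rw [Matrix.trace_mul_comm, hL])

/-- The Kraus operators `|i⟩⟨j| L` have `∑ K†K = d L†L ≤ d`. -/
theorem diamondBound_depolarizedJumpMap {L : Matrix m m ℂ} (hL : (L * Lᴴ).trace = 1) :
    DiamondBound (depolarizedJumpMap L) (Fintype.card m) := by
  refine DiamondBound.krausMap _ ?_
  have h : ∑ x : m × m, (Matrix.single x.1 x.2 (1 : ℂ) * L)ᴴ * (Matrix.single x.1 x.2 1 * L)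
      = ((Fintype.card m : ℝ) : ℂ) • (Lᴴ * L) := by
    have hx : ∀ x : m × m, (Matrix.single x.1 x.2 (1 : ℂ) * L)ᴴ * (Matrix.single x.1 x.2 1 * L)
        = Lᴴ * Matrix.single x.2 x.2 1 * L := fun x => by
      rw [Matrix.conjTranspose_mul, Matrix.conjTranspose_single, star_one, Matrix.mul_assoc,
        ← Matrix.mul_assoc (Matrix.single _ _ _), Matrix.single_mul_single_same, mul_one,
        Matrix.mul_assoc]
    have h1 : ∑ j : m, Matrix.single j j (1 : ℂ) = 1 := Matrix.sum_single_one
    simp only [hx, Fintype.sum_prod_type]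
    rw [Finset.sum_const, ← Matrix.sum_mul, ← Matrix.mul_sum, h1, Matrix.mul_one,
      ← Nat.cast_smul_eq_nsmul ℂ]
    simp
  rw [h, ← smul_sub]
  have := (posSemidef_one_sub (Matrix.posSemidef_conjTranspose_mul_self L)
      (by rw [Matrix.trace_mul_comm, hL])).smul (α := ℝ) (a := Fintype.card m) (by positivity)
  convert this using 1
  ext i j
  simp

end Lindblad

/-! ### A single simulation step -/

section Step

variable {d : ℕ}

theorem programVector_apply (L : Matrix (Fin d) (Fin d) ℂ) (x : Fin d × Fin d) :
    programVector L x = L x.1 x.2 := by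
  simp [programVector, maxEntangled, Matrix.mulVec, dotProduct, Fintype.sum_prod_type,
    Matrix.one_apply]

theorem programState_apply (L : Matrix (Fin d) (Fin d) ℂ) (x y : Fin d × Fin d) :
    programState L x y = L x.1 x.2 * star (L y.1 y.2) := by
  simp [programState, vecMulVec_apply, programVector_apply]

/-- The Kraus operator `I ⊗ ⟨i|⟨j|` of the partial trace over the program. -/
def traceKraus (d : ℕ) (x : Fin d × Fin d) : Matrix (Fin d) (Fin d × (Fin d × Fin d)) ℂ :=
  Matrix.of fun a y => if y = (a, x) then 1 else 0

/-- The operator `(I ⊗ ⟨i|⟨j|)(|Γ⟩⟨Γ|₁₃ ⊗ I₂)`. -/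
def decayKraus (d : ℕ) (x : Fin d × Fin d) : Matrix (Fin d) (Fin d × (Fin d × Fin d)) ℂ :=
  Matrix.of fun a y => if y.1 = y.2.2 ∧ y.2.1 = x.1 ∧ a = x.2 then 1 else 0

/-- The operator `⟨Γ|₂₃ (SWAP₁₂ ⊗ I₃)`, which applies the programmed jump. -/
def swapKraus (d : ℕ) : Matrix (Fin d) (Fin d × (Fin d × Fin d)) ℂ :=
  Matrix.of fun a y => if y.1 = y.2.2 ∧ y.2.1 = a then 1 else 0

/-- The operator `|Γ⟩⟨Γ|₁₃ ⊗ I₂`. -/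
def entangledOp (d : ℕ) : Matrix (Fin d × (Fin d × Fin d)) (Fin d × (Fin d × Fin d)) ℂ :=
  Matrix.of fun y z => if y.1 = y.2.2 ∧ y.2.1 = z.2.1 ∧ z.1 = z.2.2 then 1 else 0

theorem swap_mul_swap : (swapKraus d)ᴴ * swapKraus d = entangledOp d := by
  ext ⟨b, c, e⟩ ⟨b', c', e'⟩
  simp [swapKraus, entangledOp, Matrix.mul_apply, ite_and, apply_ite]
  grind

theorem sum_trace_mul_trace :
    ∑ x, (traceKraus d x)ᴴ * traceKraus d x = 1 := by
  ext ⟨b, c, e⟩ ⟨b', c', e'⟩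
  simp [traceKraus, Matrix.mul_apply, Matrix.sum_apply, ite_and,
    apply_ite, Matrix.one_apply]
  grind

theorem sum_trace_mul_decay :
    ∑ x, (traceKraus d x)ᴴ * decayKraus d x = entangledOp d := by
  ext ⟨b, c, e⟩ ⟨b', c', e'⟩
  simp [traceKraus, decayKraus, entangledOp, Matrix.mul_apply, Matrix.sum_apply,
    Fintype.sum_prod_type, ite_and, apply_ite]
  grind

theorem sum_decay_mul_trace :
    ∑ x, (decayKraus d x)ᴴ * traceKraus d x = entangledOp d := by
  ext ⟨b, c, e⟩ ⟨b', c', e'⟩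
  simp [traceKraus, decayKraus, entangledOp, Matrix.mul_apply, Matrix.sum_apply,
    ite_and, apply_ite]
  grind

/-- `decayKraus` is `traceKraus` composed with `entangledOp`, so the sum is `E²`; the factor is
`⟨Γ|Γ⟩ = d`. -/
theorem sum_decay_mul_decay :
    ∑ x, (decayKraus d x)ᴴ * decayKraus d x = (d : ℂ) • entangledOp d := by
  ext ⟨b, c, e⟩ ⟨b', c', e'⟩
  simp [decayKraus, entangledOp, Matrix.mul_apply, Matrix.sum_apply,
    Fintype.sum_prod_type, ite_and, apply_ite]
  grind

variable {L : Matrix (Fin d) (Fin d) ℂ} (ρ : Matrix (Fin d) (Fin d) ℂ)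

theorem sum_trace_conj_trace (hL : (L * Lᴴ).trace = 1) :
    ∑ x, traceKraus d x * (ρ ⊗ₖ programState L) * (traceKraus d x)ᴴ = ρ := by
  have h : ∑ i, ∑ j, L i j * star (L i j) = 1 := by
    simpa [Matrix.trace, Matrix.mul_apply] using hL
  ext a b
  simp only [traceKraus, Matrix.mul_apply, Matrix.sum_apply, programState_apply,
    Matrix.kroneckerMap_apply, Matrix.of_apply, Matrix.conjTranspose_apply, apply_ite star,
    star_one, star_zero, ite_mul, mul_ite, one_mul, zero_mul, mul_one, mul_zero,
    Finset.sum_ite_eq', Finset.mem_univ, if_true, ← Finset.mul_sum]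
  rw [Fintype.sum_prod_type, h, mul_one]

theorem sum_trace_conj_decay :
    ∑ x, traceKraus d x * (ρ ⊗ₖ programState L) * (decayKraus d x)ᴴ = ρ * (Lᴴ * L) := by
  ext a b
  simp [traceKraus, decayKraus, Matrix.mul_apply, Matrix.sum_apply, programState_apply,
    Fintype.sum_prod_type, ite_and, apply_ite, Finset.mul_sum]
  rw [Finset.sum_comm]
  exact Finset.sum_congr rfl fun _ _ => Finset.sum_congr rfl fun _ _ => by ring

theorem sum_decay_conj_trace :
    ∑ x, decayKraus d x * (ρ ⊗ₖ programState L) * (traceKraus d x)ᴴ = Lᴴ * L * ρ := by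
  ext a b
  simp [traceKraus, decayKraus, Matrix.mul_apply, Matrix.sum_apply, programState_apply,
    Fintype.sum_prod_type, ite_and, apply_ite]
  simp only [Finset.sum_mul]
  rw [Finset.sum_comm]
  exact Finset.sum_congr rfl fun _ _ => Finset.sum_congr rfl fun _ _ => by ring

theorem sum_decay_conj_decay :
    ∑ x, decayKraus d x * (ρ ⊗ₖ programState L) * (decayKraus d x)ᴴ = (L * ρ * Lᴴ).trace • 1 := by
  ext a b
  simp [decayKraus, Matrix.mul_apply, Matrix.sum_apply, programState_apply, Matrix.trace,
    Fintype.sum_prod_type, ite_and, apply_ite, Matrix.one_apply]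
  have h : ∑ x, ∑ y, ∑ z, ρ z y * (L x z * (starRingEnd ℂ) (L x y))
      = ∑ i, ∑ j, (∑ k, L i k * ρ k j) * (starRingEnd ℂ) (L i j) := by
    simp only [Finset.sum_mul]
    exact Finset.sum_congr rfl fun _ _ => Finset.sum_congr rfl fun _ _ =>
      Finset.sum_congr rfl fun _ _ => by ring
  split_ifs with hab
  · exact h
  · simp [hab]

/-- Postselected gate teleportation: projecting the input and the second program half onto `|Γ⟩`
leaves `L` applied to the input in the first program half. -/
theorem swap_conj_swap :
    swapKraus d * (ρ ⊗ₖ programState L) * (swapKraus d)ᴴ = L * ρ * Lᴴ := by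
  ext a b
  simp [swapKraus, Matrix.mul_apply, programState_apply,
    Fintype.sum_prod_type, ite_and, apply_ite]
  simp only [Finset.sum_mul]
  exact Finset.sum_congr rfl fun _ _ => Finset.sum_congr rfl fun _ _ => by ring

end Step

/-! ### The simulation channel -/

section Simulation

/-- Kraus operators of a channel that approximates the evolution for time `δ` to first order,
consuming one program state. -/
def stepKraus (d : ℕ) (δ : ℝ) :
    Option (Fin d × Fin d) → Matrix (Fin d) (Fin d × (Fin d × Fin d)) ℂ
  | none => ((√(δ - δ ^ 2 * d / 4) : ℝ) : ℂ) • swapKraus d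
  | some x => traceKraus d x - ((δ / 2 : ℝ) : ℂ) • decayKraus d x

variable {d : ℕ} {δ : ℝ}

/-- The `some` branch contributes `(1 - (δ/2)E)² = 1 - δE + (δ²d/4)E`, and the weight of the swap
branch is exactly the deficit. -/
theorem sum_stepKraus (hδ : 0 ≤ δ - δ ^ 2 * d / 4) :
    ∑ i, (stepKraus d δ i)ᴴ * stepKraus d δ i = 1 := by
  have hs : ((√(δ - δ ^ 2 * d / 4) : ℝ) : ℂ) * ((√(δ - δ ^ 2 * d / 4) : ℝ) : ℂ)
      = δ - δ ^ 2 * d / 4 := by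
    rw [← Complex.ofReal_mul, Real.mul_self_sqrt hδ]
    push_cast
    rfl
  have hnone : (stepKraus d δ none)ᴴ * stepKraus d δ none
      = ((δ : ℂ) - δ ^ 2 * d / 4) • entangledOp d := by
    simp only [stepKraus]
    rw [Matrix.conjTranspose_smul, Matrix.smul_mul, Matrix.mul_smul, smul_smul, swap_mul_swap,
      RCLike.star_def, Complex.conj_ofReal, hs]
  have hsome : ∀ x, (stepKraus d δ (some x))ᴴ * stepKraus d δ (some x)
      = (traceKraus d x)ᴴ * traceKraus d x
        - ((δ / 2 : ℝ) : ℂ) • ((traceKraus d x)ᴴ * decayKraus d x)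
        - ((δ / 2 : ℝ) : ℂ) • ((decayKraus d x)ᴴ * traceKraus d x)
        + ((δ ^ 2 / 4 : ℝ) : ℂ) • ((decayKraus d x)ᴴ * decayKraus d x) := fun x => by
    simp only [stepKraus]
    rw [Matrix.conjTranspose_sub, Matrix.conjTranspose_smul, RCLike.star_def,
      Complex.conj_ofReal]
    simp only [Matrix.sub_mul, Matrix.mul_sub, Matrix.smul_mul, Matrix.mul_smul]
    push_cast
    module
  rw [Fintype.sum_option, hnone]
  simp only [hsome]
  rw [Finset.sum_add_distrib, Finset.sum_sub_distrib, Finset.sum_sub_distrib, ← Finset.smul_sum,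
    ← Finset.smul_sum, ← Finset.smul_sum, sum_trace_mul_trace, sum_trace_mul_decay,
    sum_decay_mul_trace, sum_decay_mul_decay]
  push_cast
  module

theorem krausMap_stepKraus_comp_append (hδ : 0 ≤ δ - δ ^ 2 * d / 4)
    {L : Matrix (Fin d) (Fin d) ℂ} (hL : (L * Lᴴ).trace = 1) :
    krausMap (stepKraus d δ) ∘ₗ append (programState L)
      = 1 + (δ : ℂ) • lindbladian L
        + ((δ ^ 2 / 4 : ℝ) : ℂ) • (depolarizedJumpMap L - ((d : ℝ) : ℂ) • jumpMap L) := by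
  ext1 ρ
  have hs : ((√(δ - δ ^ 2 * d / 4) : ℝ) : ℂ) * ((√(δ - δ ^ 2 * d / 4) : ℝ) : ℂ)
      = δ - δ ^ 2 * d / 4 := by
    rw [← Complex.ofReal_mul, Real.mul_self_sqrt hδ]
    push_cast
    rfl
  have hnone : stepKraus d δ none * (ρ ⊗ₖ programState L) * (stepKraus d δ none)ᴴ
      = ((δ : ℂ) - δ ^ 2 * d / 4) • (L * ρ * Lᴴ) := by
    simp only [stepKraus]
    rw [Matrix.conjTranspose_smul, Matrix.smul_mul, Matrix.smul_mul, Matrix.mul_smul, smul_smul,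
      swap_conj_swap, RCLike.star_def, Complex.conj_ofReal, hs]
  have hsome : ∀ x, stepKraus d δ (some x) * (ρ ⊗ₖ programState L) * (stepKraus d δ (some x))ᴴ
      = traceKraus d x * (ρ ⊗ₖ programState L) * (traceKraus d x)ᴴ
        - ((δ / 2 : ℝ) : ℂ) • (traceKraus d x * (ρ ⊗ₖ programState L) * (decayKraus d x)ᴴ)
        - ((δ / 2 : ℝ) : ℂ) • (decayKraus d x * (ρ ⊗ₖ programState L) * (traceKraus d x)ᴴ)
        + ((δ ^ 2 / 4 : ℝ) : ℂ) •
          (decayKraus d x * (ρ ⊗ₖ programState L) * (decayKraus d x)ᴴ) := fun x => by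
    simp only [stepKraus]
    rw [Matrix.conjTranspose_sub, Matrix.conjTranspose_smul, RCLike.star_def,
      Complex.conj_ofReal]
    simp only [Matrix.sub_mul, Matrix.mul_sub, Matrix.smul_mul, Matrix.mul_smul]
    push_cast
    module
  rw [LinearMap.comp_apply, append_apply, krausMap_apply, Fintype.sum_option, hnone]
  simp only [hsome]
  rw [Finset.sum_add_distrib, Finset.sum_sub_distrib, Finset.sum_sub_distrib, ← Finset.smul_sum,
    ← Finset.smul_sum, ← Finset.smul_sum, sum_trace_conj_trace ρ hL, sum_trace_conj_decay,
    sum_decay_conj_trace, sum_decay_conj_decay]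
  simp only [LinearMap.add_apply, LinearMap.smul_apply, LinearMap.sub_apply, Module.End.one_apply,
    depolarizedJumpMap_apply, jumpMap_apply, lindbladian, LinearMap.coe_mk, AddHom.coe_mk]
  push_cast
  module

theorem star_programVector_dotProduct {L : Matrix (Fin d) (Fin d) ℂ}
    (hL : (L * Lᴴ).trace = 1) : star (programVector L) ⬝ᵥ programVector L = 1 := by
  rw [← hL]
  simp [dotProduct, programVector_apply, Fintype.sum_prod_type, Matrix.trace, Matrix.mul_apply,
    mul_comm]

/-- A single step simulates the evolution for time `δ` up to a second-order error. -/
theorem diamondBound_step_sub_evolution (hd : 2 ≤ d) (hδ0 : 0 ≤ δ) (hδ1 : 2 * δ ≤ 1)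
    (hδ : 0 ≤ δ - δ ^ 2 * d / 4) {L : Matrix (Fin d) (Fin d) ℂ} (hL : (L * Lᴴ).trace = 1) :
    DiamondBound (krausMap (stepKraus d δ) ∘ₗ append (programState L)
      - evolution (lindbladian L) δ) (5 / 4 * d ^ 2 * δ ^ 2) := by
  have hT := (diamondBound_lindbladian hL).evolution_sub zero_le_two hδ0
  have hR := ((diamondBound_depolarizedJumpMap hL).sub
    ((diamondBound_jumpMap hL).smul (Nat.cast_nonneg d))).smul (a := δ ^ 2 / 4) (by positivity)
  have h := hR.sub hT
  rw [krausMap_stepKraus_comp_append hδ hL]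
  have heq : (1 + (δ : ℂ) • lindbladian L
        + ((δ ^ 2 / 4 : ℝ) : ℂ) • (depolarizedJumpMap L - ((d : ℝ) : ℂ) • jumpMap L))
        - evolution (lindbladian L) δ
      = ((δ ^ 2 / 4 : ℝ) : ℂ) • (depolarizedJumpMap L - ((d : ℝ) : ℂ) • jumpMap L)
        - (evolution (lindbladian L) δ - 1 - (δ : ℂ) • lindbladian L) := by
    abel
  rw [heq]
  refine h.mono ?_
  have hexp := (abs_le.mp (Real.abs_exp_sub_one_sub_id_le (x := 2 * δ)
    (abs_le.mpr ⟨by linarith, hδ1⟩))).2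
  have hd' : (2 : ℝ) ≤ d := by exact_mod_cast hd
  rw [Fintype.card_fin]
  -- The total is at most `(d/2 + 4)δ²`; `d/2 ≤ d²/4` and `4 ≤ d²` give the constant `5/4`.
  have h1 : (2 : ℝ) * d ≤ d ^ 2 := by nlinarith
  have h2 : (4 : ℝ) ≤ d ^ 2 := by nlinarith
  nlinarith [mul_le_mul_of_nonneg_right h1 (sq_nonneg δ),
    mul_le_mul_of_nonneg_right h2 (sq_nonneg δ)]

/-- The slack `n + 1` in place of `n` lets the floor of `3d²t²/ε` serve as the number of copies; it
costs at most a factor 2, as `n + 1 ≤ 2n`. -/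
theorem simulable_of_le {t ε : ℝ} {n : ℕ} (hd : 2 ≤ d) (ht : 0 ≤ t) (hε : 0 < ε) (hε1 : ε ≤ 1)
    (hn : 1 ≤ n) (h : 3 * (d : ℝ) ^ 2 * t ^ 2 ≤ ε * (n + 1)) : Simulable d t ε n := by
  have hd' : (2 : ℝ) ≤ d := by exact_mod_cast hd
  have hn' : (1 : ℝ) ≤ n := by exact_mod_cast hn
  obtain ⟨δ, rfl⟩ : ∃ δ : ℝ, t = n * δ := ⟨t / n, by field_simp⟩
  have hδ0 : 0 ≤ δ := nonneg_of_mul_nonneg_right ht (by linarith)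
  -- From `3d²n²δ² ≤ ε(n + 1) ≤ 2nε` follows `d²nδ² ≤ 2ε/3`.
  have hnη : n * (5 / 4 * (d : ℝ) ^ 2 * δ ^ 2) ≤ 5 / 6 * ε := by
    have h1 : (n : ℝ) * (3 * (d : ℝ) ^ 2 * (n * δ ^ 2)) ≤ n * (2 * ε) := by
      nlinarith
    have h2 := le_of_mul_le_mul_left h1 (by linarith)
    linarith
  have hdδ : (d * δ) ^ 2 ≤ 1 := by
    have : (1 : ℝ) * (d * δ) ^ 2 ≤ n * (d * δ) ^ 2 :=
      mul_le_mul_of_nonneg_right hn' (sq_nonneg _)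
    nlinarith
  have hdδ1 : d * δ ≤ 1 := by
    have := abs_le_one_iff_mul_self_le_one.mpr (by simpa [sq] using hdδ : d * δ * (d * δ) ≤ 1)
    exact (abs_le.mp this).2
  have hδ1 : 2 * δ ≤ 1 := (mul_le_mul_of_nonneg_right hd' hδ0).trans hdδ1
  have hδ : 0 ≤ δ - δ ^ 2 * d / 4 := by nlinarith
  obtain ⟨κ, _, J, hJ, hJτ⟩ := exists_sequential_channel (stepKraus d δ) (sum_stepKraus hδ) n
  refine ⟨krausMap J, isChannel_krausMap J hJ, fun L hL => ?_⟩
  have hL' := trace_mul_conjTranspose_eq_one hL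
  rw [hJτ, evolution_natCast_mul]
  have hstep := diamondBound_step_sub_evolution hd hδ0 hδ1 hδ hL'
  have hS : DiamondBound (krausMap (stepKraus d δ) ∘ₗ append (programState L)) 1 := by
    have := (DiamondBound.krausMap_of_sum_eq_one _ (sum_stepKraus hδ)).comp
      (DiamondBound.append_vecMulVec _ (star_programVector_dotProduct hL')) zero_le_one
    rwa [one_mul] at this
  set η : ℝ := 5 / 4 * d ^ 2 * δ ^ 2 with hη
  have hη0 : 0 ≤ η := by positivity
  have hpow := (DiamondBound.pow_sub_pow hS hstep hη0 n).diamondNorm_le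
  -- With `nη ≤ 5ε/6 ≤ 1`, `e^{nη} - 1 ≤ nη + (nη)² ≤ (5/6 + 25/36)ε`, where the square uses `ε ≤
  -- 1`. The target is `2ε` because of the factor `1/2` in the error.
  have hbound : (1 + η) ^ n - 1 ≤ 2 * ε := by
    have h1 : (1 + η) ^ n ≤ Real.exp (n * η) := by
      rw [Real.exp_nat_mul]
      exact pow_le_pow_left₀ (by positivity) (by linarith [Real.add_one_le_exp η]) n
    have hnη0 : 0 ≤ n * η := by positivity
    have h2 := (abs_le.mp (Real.abs_exp_sub_one_sub_id_le (x := n * η)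
      (abs_le.mpr ⟨by linarith, by linarith⟩))).2
    nlinarith
  calc (1 / 2 : ℝ≥0∞) * _ ≤ (1 / 2) * ENNReal.ofReal (2 * ε) := by
        gcongr
        exact hpow.trans (ENNReal.ofReal_le_ofReal hbound)
    _ = ENNReal.ofReal ε := by
        rw [ENNReal.ofReal_mul zero_le_two, ENNReal.ofReal_ofNat, ← mul_assoc, one_div,
          ENNReal.inv_mul_cancel two_ne_zero ENNReal.ofNat_ne_top, one_mul]

/-- At `t = 0` the ceiling is 0, a case that the condition `1 ≤ n` in `simulable_of_le` leaves out.
-/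
theorem simulable_zero (d : ℕ) (ε : ℝ) : Simulable d 0 ε 0 := by
  obtain ⟨κ, _, J, hJ, hJτ⟩ :=
    exists_sequential_channel (stepKraus d 0) (sum_stepKraus (by simp)) 0
  refine ⟨krausMap J, isChannel_krausMap J hJ, fun L _ => ?_⟩
  have hev : evolution (lindbladian L) 0 = 1 := by
    simpa using evolution_natCast_mul (lindbladian L) 0 0
  have h0 : DiamondBound (0 : Module.End ℂ (Matrix (Fin d) (Fin d) ℂ)) 0 := by
    simpa using (DiamondBound.one (n := Fin d)).smul le_rfl
  rw [hJτ, hev, pow_zero, sub_self]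
  have := h0.diamondNorm_le
  rw [ENNReal.ofReal_zero, nonpos_iff_eq_zero] at this
  rw [this, mul_zero]
  exact zero_le

theorem sampleComplexity_le {t ε : ℝ} {n : ℕ} (h : Simulable d t ε n) :
    sampleComplexity d t ε ≤ n :=
  iInf₂_le n h

end Simulation

end LindbladSim

end

theorem corollary2 (d : ℕ) (hd : 2 ≤ d) (t ε : ℝ) (ht : 0 ≤ t) (hε : 0 < ε) (hε1 : ε ≤ 1) :
    (ε ≤ 3 * (d : ℝ) ^ 2 * t ^ 2 →
      (LindbladSim.sampleComplexity d t ε : ℝ≥0∞) ≤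
        ENNReal.ofReal (3 * (d : ℝ) ^ 2 * (t ^ 2 / ε))) ∧
    LindbladSim.sampleComplexity d t ε ≤ (⌈3 * (d : ℝ) ^ 2 * (t ^ 2 / ε)⌉₊ : ℕ∞) := by
  set x : ℝ := 3 * (d : ℝ) ^ 2 * (t ^ 2 / ε) with hx
  have hx0 : 0 ≤ x := by positivity
  have hxε : 3 * (d : ℝ) ^ 2 * t ^ 2 = ε * x := by
    rw [hx]
    field_simp
  refine ⟨fun h => ?_, ?_⟩
  · rw [hxε] at h
    have hx1 : 1 ≤ x := by
      by_contra! hlt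
      nlinarith
    -- The floor, not the ceiling, is needed for a bound by the real number `x` itself; `1 ≤ x`
    -- keeps it positive.
    have hsim : LindbladSim.Simulable d t ε ⌊x⌋₊ :=
      LindbladSim.simulable_of_le hd ht hε hε1 ((Nat.one_le_floor_iff x).mpr hx1) (by
        rw [hxε]
        exact mul_le_mul_of_nonneg_left (Nat.lt_floor_add_one x).le hε.le)
    calc (LindbladSim.sampleComplexity d t ε : ℝ≥0∞) ≤ ((⌊x⌋₊ : ℕ∞) : ℝ≥0∞) :=
          ENat.toENNReal_le.mpr (LindbladSim.sampleComplexity_le hsim)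
      _ = ENNReal.ofReal (⌊x⌋₊ : ℝ) := by simp
      _ ≤ ENNReal.ofReal x := ENNReal.ofReal_le_ofReal (Nat.floor_le hx0)
  · refine LindbladSim.sampleComplexity_le ?_
    rcases hx0.eq_or_lt with h0 | hpos
    · have ht0 : t = 0 := by
        have hd0 : (d : ℝ) ≠ 0 := by positivity
        rw [← h0, mul_zero] at hxε
        simpa [hd0] using hxε
      rw [← h0, Nat.ceil_zero, ht0]
      exact LindbladSim.simulable_zero d ε
    · refine LindbladSim.simulable_of_le hd ht hε hε1 (Nat.one_le_ceil_iff.mpr hpos) ?_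
      rw [hxε]
      exact mul_le_mul_of_nonneg_left ((Nat.le_ceil x).trans (by linarith)) hε.le
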